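/- **Theorem 3.1 (corrected version).** Let $X$ and $Z$ be real Banach spaces such that the pair $(X,Z)$ has the following two properties. * Property (*): there is a constant $C_0\ge 1$, depending only on $X$ and $Z$, such that for every subset $S\subset X$, every Lipschitz mapping $h:S\to Z$ and every $\varepsilon>0$ there is a $C^1$ smooth Lipschitz mapping $g:X\to Z$ with $\|h(x)-g(x)\|<\varepsilon$ for all $x\in S$ and $\operatorname{Lip}(g)\le C_0\operatorname{Lip}(h)$. * Property (E): there is a constant $K>0$, depending only on $X$ and $Z$, such that for every subset $S\subset X$, every Lipschitz mapping $h:S\to Z$ has a Lipschitz extension $H:X\to Z$ with $\operatorname{Lip}(H)\le K\operatorname{Lip}(h)$. Let $A\subset X$ be closed, and let $f:A\to Z$ and $D:A\to\mathcal L(X,Z)$ be mappings, where $\mathcal L(X,Z)$ is the space of bounded linear operators with the operator norm. Say that $f$ satisfies the mean value condition on $A$ for $D$ if $D$ is continuous and, for every $y\in A$ and every $\varepsilon>0$, there is $r>0$ such that $$\|f(z)-f(w)-D(y)(z-w)\|\le\varepsilon\|z-w\|\qquad\text{for all } z,w\in A\cap B(y,r),$$ where $B(y,r)$ is the open ball.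 If $f$ satisfies the mean value condition on $A$ for $D$, then there is a $C^1$ smooth mapping $G:X\to Z$ with $G(y)=f(y)$ and $G'(y)=D(y)$ for all $y\in A$. Conversely, if such a mapping $G$ exists, then $f$ satisfies the mean value condition on $A$ for $D$. -/

import Mathlib

open scoped NNReal

/-- Property (*) of a pair `(X, Z)`: there is a constant `C₀ ≥ 1`, depending only on `X` and `Z`,
such that every Lipschitz mapping `f : S → Z` on a subset `S ⊆ X` can be uniformly approximated
on `S`, to any precision, by `C¹` smooth mappings `g : X → Z` with `Lip g ≤ C₀ * Lip f`.
The mapping `f` is written as a total function; only its values on `S` matter. -/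
def PropertyStar (X Z : Type*) [NormedAddCommGroup X] [NormedSpace ℝ X]
    [NormedAddCommGroup Z] [NormedSpace ℝ Z] : Prop :=
  ∃ C₀ : ℝ≥0, 1 ≤ C₀ ∧ ∀ (S : Set X) (f : X → Z) (L : ℝ≥0), LipschitzOnWith L f S →
    ∀ ε : ℝ, 0 < ε → ∃ g : X → Z, ContDiff ℝ 1 g ∧ LipschitzWith (C₀ * L) g ∧
      ∀ x ∈ S, ‖f x - g x‖ < ε

/-- Property (E) of a pair `(X, Z)`: there is a constant `K > 0`, depending only on `X` and `Z`,
such that every Lipschitz mapping `f : S → Z` on a subset `S ⊆ X` has an extension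
`F : X → Z` with `Lip F ≤ K * Lip f`. -/
def PropertyE (X Z : Type*) [NormedAddCommGroup X] [NormedAddCommGroup Z] : Prop :=
  ∃ K : ℝ≥0, 0 < K ∧ ∀ (S : Set X) (f : X → Z) (L : ℝ≥0), LipschitzOnWith L f S →
    ∃ F : X → Z, LipschitzWith (K * L) F ∧ ∀ x ∈ S, F x = f x

/-- The mapping `f : A → Z` satisfies the mean value condition on `A` for the continuous
mapping `D : A → L(X, Z)`. Only the values of `f` and `D` on `A` matter. -/
def MeanValueCondition {X Z : Type*} [NormedAddCommGroup X] [NormedSpace ℝ X]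
    [NormedAddCommGroup Z] [NormedSpace ℝ Z]
    (A : Set X) (f : X → Z) (D : X → X →L[ℝ] Z) : Prop :=
  ContinuousOn D A ∧ ∀ y ∈ A, ∀ ε : ℝ, 0 < ε → ∃ r : ℝ, 0 < r ∧
    ∀ z ∈ A ∩ Metric.ball y r, ∀ w ∈ A ∩ Metric.ball y r,
      ‖f z - f w - D y (z - w)‖ ≤ ε * ‖z - w‖

open Filter Topology Metric

/-! Necessity is strict differentiability of `C¹` mappings. For sufficiency, near each point `f`
minus a linear map `T` has small Lipschitz constant on `A`; (E) extends this remainder and (*)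
smooths it, so `f` is approximated locally by `C¹` mappings with derivative close to `T`, to any
precision in value.

Gluing must keep the Lipschitz constant of the error small. Partition functions may be steep, but
they are organised in countably many levels, each with its own Lipschitz bound `b n` and separation
scale `ρ n`. Local errors at level `n` are made so small that the steepness costs at most `ε / 2 ^
(n + 1)`.

The glued `H` matches `f` and `D` on `A` only up to `η`. The residual again satisfies the mean value
condition, now with small Lipschitz constant `L`, and `exists_approx_of_lipschitz` corrects it by a
mapping with global Lipschitz constant of order `L`. Iterating with `L = (1 / 2) ^ n` gives
convergence in `C¹`, by `exists_contDiff_limit`. -/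

/-! ### Smooth separating functions from Property (*). -/

/-- `X` has `C¹` bump functions separating a set from the complement of its `r`-thickening, with
Lipschitz constant proportional to `1 / r`. -/
def HasSmoothSeparation (X : Type*) [NormedAddCommGroup X] [NormedSpace ℝ X] : Prop :=
  ∃ M : ℝ, 0 ≤ M ∧ ∀ (S : Set X) (r : ℝ), 0 < r → ∃ φ : X → ℝ, ContDiff ℝ 1 φ ∧
    (∀ x, 0 ≤ φ x) ∧ (∀ x, φ x ≤ 1) ∧ (∀ x y, |φ x - φ y| ≤ M / r * ‖x - y‖) ∧
    (∀ x ∈ thickening (r / 4) S, φ x = 1) ∧ ∀ x, x ∉ thickening r S → φ x = 0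

/-- The reals embed isometrically in `Z` along a unit vector, and a norming functional of norm one
maps the approximation back without increasing Lipschitz constants. -/
theorem PropertyStar.real {X Z : Type*} [NormedAddCommGroup X] [NormedSpace ℝ X]
    [NormedAddCommGroup Z] [NormedSpace ℝ Z] [Nontrivial Z] (h : PropertyStar X Z) :
    PropertyStar X ℝ := by
  obtain ⟨C, hC, h⟩ := h
  obtain ⟨z, hz⟩ := exists_norm_eq Z zero_le_one
  obtain ⟨l, hl, hlz⟩ := exists_dual_vector ℝ z (norm_ne_zero_iff.1 (by simp [hz]))
  refine ⟨C, hC, fun S f L hf ε hε => ?_⟩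
  obtain ⟨g, hg, hgL, hgf⟩ := h S (fun x => f x • z) L (by
    refine LipschitzOnWith.of_dist_le_mul fun x hx y hy => ?_
    have := hf.dist_le_mul x hx y hy
    rwa [dist_eq_norm, ← sub_smul, norm_smul, hz, mul_one, ← dist_eq_norm]) ε hε
  have hle : ∀ v, ‖l v‖ ≤ ‖v‖ := fun v => by simpa [hl] using l.le_opNorm v
  refine ⟨fun x => l (g x), l.contDiff.comp hg, ?_, fun x hx => ?_⟩
  · refine LipschitzWith.of_dist_le_mul fun x y => ?_
    refine le_trans ?_ (hgL.dist_le_mul x y)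
    rw [dist_eq_norm, dist_eq_norm, ← map_sub]
    exact hle _
  · have h1 : f x - l (g x) = l (f x • z - g x) := by simp [hlz, hz]
    rw [h1]
    exact (hle _).trans_lt (hgf x hx)

/-- Smooth the distance to `S` and compose with a fixed bump function rescaled by `r`. -/
theorem PropertyStar.hasSmoothSeparation {X : Type*} [NormedAddCommGroup X] [NormedSpace ℝ X]
    (h : PropertyStar X ℝ) : HasSmoothSeparation X := by
  obtain ⟨C, hC, h⟩ := h
  -- With error below `r / 4`, distance below `r / 4` becomes at most `r / 2`, and distance at least
  -- `r` stays above `3 / 4 * r`.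
  let β : ContDiffBump (0 : ℝ) := ⟨1 / 2, 3 / 4, by norm_num, by norm_num⟩
  have hβ : ContDiff ℝ 1 β := β.contDiff
  obtain ⟨B, hB⟩ := hβ.lipschitzWith_of_hasCompactSupport β.hasCompactSupport one_ne_zero
  refine ⟨B * C, by positivity, fun S r hr => ?_⟩
  rcases S.eq_empty_or_nonempty with rfl | hS
  · refine ⟨fun _ => 0, contDiff_const, fun _ => le_rfl, fun _ => zero_le_one, fun x y => ?_,
      fun x hx => ?_, fun _ _ => rfl⟩
    · simp only [sub_self, abs_zero]; positivity
    · simp at hx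
  obtain ⟨g, hg, hgL, hgS⟩ := h Set.univ (fun x => infDist x S) 1
    (lipschitz_infDist_pt S).lipschitzOnWith (r / 4) (by positivity)
  have hgS' : ∀ x, |infDist x S - g x| < r / 4 := fun x => hgS x trivial
  refine ⟨fun x => β (g x / r), hβ.comp (hg.div_const r), fun x => β.nonneg, fun x => β.le_one,
    fun x y => ?_, fun x hx => ?_, fun x hx => ?_⟩
  · have h1 := hB.dist_le_mul (g x / r) (g y / r)
    have h2 := hgL.dist_le_mul x y
    rw [Real.dist_eq, Real.dist_eq, ← sub_div, abs_div, abs_of_pos hr] at h1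
    rw [Real.dist_eq, dist_eq_norm] at h2
    push_cast at h2
    calc _ ≤ B * (|g x - g y| / r) := h1
      _ ≤ B * ((C * 1 * ‖x - y‖) / r) := by gcongr
      _ = _ := by ring
  · have h1 : infDist x S < r / 4 := by
      obtain ⟨s, hs, hxs⟩ := mem_thickening_iff.1 hx
      exact (infDist_le_dist_of_mem hs).trans_lt hxs
    have h2 := abs_lt.1 (hgS' x)
    have h3 : 0 ≤ infDist x S := infDist_nonneg
    apply β.one_of_mem_closedBall
    rw [mem_closedBall, dist_zero_right, Real.norm_eq_abs, abs_div, abs_of_pos hr, div_le_iff₀ hr]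
    change |g x| ≤ 1 / 2 * r
    rw [abs_le]; constructor <;> linarith
  · have h1 : r ≤ infDist x S := by
      by_contra! hlt
      exact hx (mem_thickening_iff.2 ((infDist_lt_iff hS).1 hlt))
    have h2 := abs_lt.1 (hgS' x)
    apply β.zero_of_le_dist
    rw [dist_zero_right, Real.norm_eq_abs, abs_div, abs_of_pos hr, le_div_iff₀ hr]
    change 3 / 4 * r ≤ |g x|
    exact le_trans (by linarith) (le_abs_self _)

/-! ### Partitions of unity in uniformly discrete levels. -/

/-- Stone's construction: an open cover of a metric space has a refinement that splits into
countably many uniformly discrete levels. -/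
theorem exists_uniformly_discrete_levels {X I : Type*} [PseudoMetricSpace X] (U : I → Set X)
    (hU : ∀ i, IsOpen (U i)) (hcov : ∀ x, ∃ i, x ∈ U i) :
    ∃ (S : ℕ → Set X) (k : ℕ → X → I) (ρ : ℕ → ℝ), (∀ n, 0 < ρ n) ∧ (∀ x, ∃ n, x ∈ S n) ∧
      (∀ n, ∀ x ∈ thickening (ρ n) (S n), x ∈ U (k n x)) ∧
      ∀ n, ∀ x ∈ thickening (ρ n) (S n), ∀ y ∈ thickening (ρ n) (S n), dist x y < ρ n →
        k n x = k n y := by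
  classical
  have wf : WellFounded (WellOrderingRel (α := I)) := IsWellFounded.wf
  let ι : X → I := fun x => wf.min {i | x ∈ U i} (hcov x)
  have hι : ∀ x, x ∈ U (ι x) := fun x => wf.min_mem {i | x ∈ U i} (hcov x)
  have hmin : ∀ x i, x ∈ U i → ¬ WellOrderingRel i (ι x) := fun x i hi =>
    wf.not_lt_min {i | x ∈ U i} hi
  -- For `x`, `y` in `S n` closer than the radius, each lies in the set chosen by the other, so
  -- minimality forces equal indices.
  let S : ℕ → Set X := fun n => {x | ball x (1 / ((n : ℝ) + 1)) ⊆ U (ι x)}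
  have hsep : ∀ n, ∀ x ∈ S n, ∀ y ∈ S n, dist x y < 1 / ((n : ℝ) + 1) → ι x = ι y := by
    intro n x hx y hy hxy
    rcases trichotomous_of WellOrderingRel (ι x) (ι y) with h | h | h
    · exact absurd h (hmin y _ (hx (mem_ball'.2 hxy)))
    · exact h
    · exact absurd h (hmin x _ (hy (mem_ball.2 hxy)))
  -- A third of the radius: two points within `ρ n` of `S n` and of each other have centres less
  -- than `3 * ρ n` apart.
  let ρ : ℕ → ℝ := fun n => 1 / ((n : ℝ) + 1) / 3
  have hρ : ∀ n, 0 < ρ n := fun n => by positivity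
  have hρ3 : ∀ n : ℕ, 1 / ((n : ℝ) + 1) = 3 * ρ n := fun n => by simp only [ρ]; ring
  let k : ℕ → X → I := fun n x =>
    if h : ∃ s ∈ S n, dist x s < ρ n then ι h.choose else ι x
  have hk : ∀ n, ∀ x ∈ thickening (ρ n) (S n), ∃ s ∈ S n, dist x s < ρ n ∧ k n x = ι s := by
    intro n x hx
    have h := mem_thickening_iff.1 hx
    exact ⟨h.choose, h.choose_spec.1, h.choose_spec.2, dif_pos h⟩
  refine ⟨S, k, ρ, hρ, fun x => ?_, fun n x hx => ?_, fun n x hx y hy hxy => ?_⟩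
  · obtain ⟨e, he, hb⟩ := isOpen_iff.1 (hU (ι x)) x (hι x)
    obtain ⟨n, hn⟩ := exists_nat_one_div_lt he
    exact ⟨n, (ball_subset_ball hn.le).trans hb⟩
  · obtain ⟨s, hs, hxs, hks⟩ := hk n x hx
    rw [hks]
    apply hs
    rw [mem_ball, hρ3]
    linarith [hρ n]
  · obtain ⟨s, hs, hxs, hks⟩ := hk n x hx
    obtain ⟨t, ht, hyt, hkt⟩ := hk n y hy
    rw [hks, hkt]
    refine hsep n s hs t ht ?_
    rw [hρ3]
    have := dist_triangle4_left s t x y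
    linarith [dist_triangle4 s x y t, dist_comm x s]

theorem abs_mul_sub_mul_le_of_unit {a b a' b' α β : ℝ} (ha : 0 ≤ a) (ha1 : a ≤ 1) (hb : 0 ≤ b')
    (hb1 : b' ≤ 1) (hα : |a - a'| ≤ α) (hβ : |b - b'| ≤ β) : |a * b - a' * b'| ≤ α + β := by
  have h : a * b - a' * b' = (a - a') * b' + a * (b - b') := by ring
  rw [h]
  refine (abs_add_le _ _).trans ?_
  rw [abs_mul, abs_mul, abs_of_nonneg hb, abs_of_nonneg ha]
  exact add_le_add ((mul_le_of_le_one_right (abs_nonneg _) hb1).trans hα)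
    ((mul_le_of_le_one_left (abs_nonneg _) ha1).trans hβ)

/-- A uniformly discrete sequence of partitions of unity subordinate to an open cover `U`: the
function `ψ n` lives on a disjoint union of pieces, each contained in the member `U i` of the cover
selected by the piecewise constant map `k n`. -/
structure LevelPartition {X I : Type*} [NormedAddCommGroup X] [NormedSpace ℝ X]
    (U : I → Set X) where
  ψ : ℕ → X → ℝ
  k : ℕ → X → I
  ρ : ℕ → ℝ
  b : ℕ → ℝ
  ρ_pos : ∀ n, 0 < ρ n
  b_nonneg : ∀ n, 0 ≤ b n
  contDiff : ∀ n, ContDiff ℝ 1 (ψ n)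
  nonneg : ∀ n x, 0 ≤ ψ n x
  lip : ∀ n x y, |ψ n x - ψ n y| ≤ b n * ‖x - y‖
  mem : ∀ n x, ψ n x ≠ 0 → x ∈ U (k n x)
  congr : ∀ n x y, ψ n x ≠ 0 → ψ n y ≠ 0 → dist x y < ρ n → k n x = k n y
  locConst : ∀ n x, ∃ i, (x ∈ U i ∨ ∀ᶠ y in 𝓝 x, ψ n y = 0) ∧
    ∀ᶠ y in 𝓝 x, ψ n y = 0 ∨ k n y = i
  locFinite : ∀ x, ∃ N₀, ∀ N, N₀ ≤ N → ∀ᶠ y in 𝓝 x,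
    (∀ n, N ≤ n → ψ n y = 0) ∧ ∑ n ∈ Finset.range N, ψ n y = 1

/-- With `R n` the product of the first `n` factors `1 - φ m`, the functions `R n - R (n + 1) = φ n
* R n` telescope to `1 - R N`, and `R N` vanishes near a point of `S m` once `N > m`. -/
theorem HasSmoothSeparation.exists_levelPartition {X I : Type*} [NormedAddCommGroup X]
    [NormedSpace ℝ X] (hX : HasSmoothSeparation X) (U : I → Set X) (hU : ∀ i, IsOpen (U i))
    (hcov : ∀ x, ∃ i, x ∈ U i) : Nonempty (LevelPartition U) := by
  obtain ⟨M, hM, hX⟩ := hX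
  obtain ⟨S, k, ρ, hρ, hS, hmem, hcongr⟩ := exists_uniformly_discrete_levels U hU hcov
  -- Half the scale leaves a margin: off the `ρ n`-thickening, `φ n` vanishes on a whole
  -- neighbourhood, as `locConst` requires.
  choose φ hφC hφ0 hφ1 hφL hφone hφzero using fun n => hX (S n) (ρ n / 2) (half_pos (hρ n))
  let R : ℕ → X → ℝ := fun n x => ∏ m ∈ Finset.range n, (1 - φ m x)
  have hRs : ∀ n x, R (n + 1) x = R n x * (1 - φ n x) := fun n x => Finset.prod_range_succ _ _
  have hR0 : ∀ n x, 0 ≤ R n x := fun n x => Finset.prod_nonneg fun m _ => sub_nonneg.2 (hφ1 m x)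
  have hR1 : ∀ n x, R n x ≤ 1 := fun n x => Finset.prod_le_one
    (fun m _ => sub_nonneg.2 (hφ1 m x)) fun m _ => sub_le_self _ (hφ0 m x)
  have hRC : ∀ n, ContDiff ℝ 1 (R n) := fun n =>
    contDiff_prod fun m _ => contDiff_const.sub (hφC m)
  let a : ℕ → ℝ := fun m => M / (ρ m / 2)
  have ha : ∀ m, 0 ≤ a m := fun m => div_nonneg hM (half_pos (hρ m)).le
  let s : ℕ → ℝ := fun n => ∑ m ∈ Finset.range n, a m
  have hs : ∀ n, 0 ≤ s n := fun n => Finset.sum_nonneg fun m _ => ha m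
  have hRL : ∀ n x y, |R n x - R n y| ≤ s n * ‖x - y‖ := by
    intro n x y
    induction n with
    | zero => simp [R, s]
    | succ n ih =>
      rw [hRs, hRs]
      refine (abs_mul_sub_mul_le_of_unit (hR0 n x) (hR1 n x) (sub_nonneg.2 (hφ1 n y))
        (sub_le_self _ (hφ0 n y)) ih (β := a n * ‖x - y‖) ?_).trans_eq ?_
      · rw [sub_sub_sub_cancel_left, norm_sub_rev]
        exact hφL n y x
      · simp only [s, Finset.sum_range_succ]; ring
  have hRmono : ∀ m n x, m ≤ n → R m x = 0 → R n x = 0 := by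
    intro m n x hmn h0
    induction n, hmn using Nat.le_induction with
    | base => exact h0
    | succ n _ ih => rw [hRs, ih, zero_mul]
  have hψ : ∀ n x, R n x - R (n + 1) x = φ n x * R n x := fun n x => by rw [hRs]; ring
  have hne : ∀ n x, R n x - R (n + 1) x ≠ 0 → x ∈ thickening (ρ n / 2) (S n) := by
    intro n x h
    by_contra hx
    exact h (by rw [hψ, hφzero n x hx, zero_mul])
  have hne' : ∀ n x, R n x - R (n + 1) x ≠ 0 → x ∈ thickening (ρ n) (S n) := fun n x h =>
    thickening_mono (half_le_self (hρ n).le) _ (hne n x h)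
  refine ⟨⟨fun n x => R n x - R (n + 1) x, k, ρ, fun n => s n + s (n + 1), hρ,
    fun n => add_nonneg (hs _) (hs _), fun n => (hRC n).sub (hRC _), fun n x => ?_,
    fun n x y => ?_, fun n x h => hmem n x (hne' n x h),
    fun n x y hx hy => hcongr n x (hne' n x hx) y (hne' n y hy), fun n x => ?_, fun x => ?_⟩⟩
  · rw [hψ]; exact mul_nonneg (hφ0 n x) (hR0 n x)
  · have h : R n x - R (n + 1) x - (R n y - R (n + 1) y) =
        (R n x - R n y) - (R (n + 1) x - R (n + 1) y) := by ring
    rw [h, add_mul]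
    exact (abs_sub _ _).trans (add_le_add (hRL _ _ _) (hRL _ _ _))
  · refine ⟨k n x, ?_, ?_⟩
    · by_cases hx : x ∈ thickening (ρ n) (S n)
      · exact Or.inl (hmem n x hx)
      · right
        filter_upwards [ball_mem_nhds x (half_pos (hρ n))] with y hy
        by_contra h
        obtain ⟨z, hz, hyz⟩ := mem_thickening_iff.1 (hne n y h)
        refine hx (mem_thickening_iff.2 ⟨z, hz, ?_⟩)
        rw [mem_ball] at hy
        linarith [dist_triangle_left x z y]
    · by_cases hx : x ∈ thickening (ρ n) (S n)
      · filter_upwards [ball_mem_nhds x (hρ n)] with y hy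
        by_cases h : R n y - R (n + 1) y = 0
        · exact Or.inl h
        · exact Or.inr (hcongr n y (hne' n y h) x hx hy)
      · filter_upwards [ball_mem_nhds x (half_pos (hρ n))] with y hy
        left
        by_contra h
        obtain ⟨z, hz, hyz⟩ := mem_thickening_iff.1 (hne n y h)
        refine hx (mem_thickening_iff.2 ⟨z, hz, ?_⟩)
        rw [mem_ball] at hy
        linarith [dist_triangle_left x z y]
  · obtain ⟨m, hm⟩ := hS x
    refine ⟨m + 1, fun N hN => ?_⟩
    have hr : 0 < ρ m / 2 / 4 := by have := hρ m; positivity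
    filter_upwards [isOpen_thickening.mem_nhds (self_subset_thickening hr _ hm)] with y hy
    have h0 : R (m + 1) y = 0 := by rw [hRs, hφone m y hy, sub_self, mul_zero]
    refine ⟨fun n hn => ?_, ?_⟩
    · rw [hRmono _ n y (hN.trans hn) h0, hRmono _ (n + 1) y (by omega) h0, sub_zero]
    · rw [Finset.sum_range_sub', hRmono _ N y hN h0, sub_zero]
      simp [R]

/-! ### Gluing with tolerances depending on the level. -/

/-- A discrete product rule that asks for control of each vector only where its weight is nonzero,
the only place where local data are meaningful. -/
theorem norm_smul_sub_smul_le {Z : Type*} [NormedAddCommGroup Z] [NormedSpace ℝ Z] {s t α β δ : ℝ}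
    {u v : Z} (ht : 0 ≤ t) (hα : |s - t| ≤ α) (hδ : 0 ≤ δ) (hβ : 0 ≤ β)
    (hu : s ≠ 0 → ‖u‖ ≤ δ) (hv : t ≠ 0 → ‖v‖ ≤ δ) (huv : s ≠ 0 → t ≠ 0 → ‖u - v‖ ≤ β) :
    ‖s • u - t • v‖ ≤ α * δ + t * β := by
  have hα0 : 0 ≤ α := (abs_nonneg _).trans hα
  by_cases hs : s = 0
  · subst hs
    by_cases ht0 : t = 0
    · subst ht0; simp; positivity
    · rw [zero_smul, zero_sub, norm_neg, norm_smul, Real.norm_eq_abs]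
      rw [zero_sub, abs_neg] at hα
      have : |t| * ‖v‖ ≤ α * δ := mul_le_mul hα (hv ht0) (norm_nonneg _) hα0
      nlinarith [mul_nonneg ht hβ]
  · have h1 : ‖(s - t) • u‖ ≤ α * δ := by
      rw [norm_smul, Real.norm_eq_abs]
      exact mul_le_mul hα (hu hs) (norm_nonneg _) hα0
    have h2 : ‖t • (u - v)‖ ≤ t * β := by
      rw [norm_smul, Real.norm_of_nonneg ht]
      by_cases ht0 : t = 0
      · simp [ht0]
      · exact mul_le_mul_of_nonneg_left (huv hs ht0) ht
    have h : s • u - t • v = (s - t) • u + t • (u - v) := by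
      rw [sub_smul, smul_sub]; abel
    rw [h]
    exact (norm_add_le _ _).trans (add_le_add h1 h2)

namespace LevelPartition

variable {X Z I : Type*} [NormedAddCommGroup X] [NormedSpace ℝ X] [NormedAddCommGroup Z]
  [NormedSpace ℝ Z] {U : I → Set X} (P : LevelPartition U)

/-- The function equal to the average, with weights `P.ψ n`, of the functions `h n i`. -/
noncomputable def glue (h : ℕ → I → X → Z) (x : X) : Z := ∑' n, P.ψ n x • h n (P.k n x) x

/-- The precision of the local data that makes the error of the gluing at most `ε`. -/
noncomputable def tol (ε : ℝ) (n : ℕ) : ℝ := ε * (1 / 2) ^ (n + 1) / (P.b n + 2 / P.ρ n)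

theorem den_pos (n : ℕ) : 0 < P.b n + 2 / P.ρ n :=
  add_pos_of_nonneg_of_pos (P.b_nonneg n) (div_pos two_pos (P.ρ_pos n))

theorem tol_pos {ε : ℝ} (hε : 0 < ε) (n : ℕ) : 0 < P.tol ε n :=
  div_pos (by positivity) (P.den_pos n)

theorem den_mul_tol (ε : ℝ) (n : ℕ) :
    (P.b n + 2 / P.ρ n) * P.tol ε n = ε * (1 / 2) ^ (n + 1) :=
  mul_div_cancel₀ _ (P.den_pos n).ne'

theorem sum_half_pow_le (N : ℕ) : ∑ n ∈ Finset.range N, (1 / 2 : ℝ) ^ (n + 1) ≤ 1 := by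
  have h : ∀ n : ℕ, (1 / 2 : ℝ) ^ (n + 1) = (1 / 2) ^ n - (1 / 2) ^ (n + 1) := fun n => by ring
  rw [Finset.sum_congr rfl fun n _ => h n, Finset.sum_range_sub']
  simp

theorem glue_eq_sum (h : ℕ → I → X → Z) {x : X} {N : ℕ} (hN : ∀ n, N ≤ n → P.ψ n x = 0) :
    P.glue h x = ∑ n ∈ Finset.range N, P.ψ n x • h n (P.k n x) x :=
  tsum_eq_sum fun n hn => by rw [hN n (by simpa using hn), zero_smul]

/-- Near `x` each selected index can be frozen wherever its weight is nonzero, so `glue` is locally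
a finite sum with fixed indices, smooth whenever the local functions are. -/
theorem exists_eventually_glue_eq (x : X) : ∃ N, ∃ i : ℕ → I,
    (∀ n, x ∈ U (i n) ∨ ∀ᶠ y in 𝓝 x, P.ψ n y = 0) ∧
    (∀ᶠ y in 𝓝 x, ∑ n ∈ Finset.range N, P.ψ n y = 1) ∧
    ∀ h : ℕ → I → X → Z, P.glue h =ᶠ[𝓝 x] fun y => ∑ n ∈ Finset.range N, P.ψ n y • h n (i n) y := by
  obtain ⟨N, hN⟩ := P.locFinite x
  choose i hi hik using fun n => P.locConst n x
  refine ⟨N, i, hi, (hN N le_rfl).mono fun y hy => hy.2, fun h => ?_⟩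
  have hall : ∀ᶠ y in 𝓝 x, ∀ n ∈ Finset.range N, P.ψ n y = 0 ∨ P.k n y = i n :=
    (Finset.eventually_all _).2 fun n _ => hik n
  filter_upwards [hN N le_rfl, hall] with y hy hy'
  rw [P.glue_eq_sum h hy.1]
  refine Finset.sum_congr rfl fun n hn => ?_
  rcases hy' n hn with h0 | h0 <;> rw [h0]
  simp

theorem contDiff_glue {h : ℕ → I → X → Z} (hh : ∀ n i, ContDiff ℝ 1 (h n i)) :
    ContDiff ℝ 1 (P.glue h) := by
  rw [contDiff_iff_contDiffAt]
  intro x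
  obtain ⟨N, i, -, -, hP⟩ := P.exists_eventually_glue_eq (Z := Z) x
  refine ContDiffAt.congr_of_eventuallyEq ?_ (hP h)
  exact (ContDiff.sum fun n _ => (P.contDiff n).smul (hh n (i n))).contDiffAt

/-- The error of the gluing on a set `B` inherits the Lipschitz constant of the local errors. -/
theorem norm_sub_glue_le {h : ℕ → I → X → Z} {ε c : ℝ} (hε : 0 < ε) (hc : 0 ≤ c) {g : X → Z}
    {B : Set X} {e : ℕ → I → X → Z} (he : ∀ n i x, ‖e n i x‖ ≤ P.tol ε n)
    (heL : ∀ n i x y, ‖e n i x - e n i y‖ ≤ c * ‖x - y‖)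
    (hB : ∀ n i, ∀ x ∈ B, x ∈ U i → g x - h n i x = e n i x) {z w : X} (hz : z ∈ B) (hw : w ∈ B) :
    ‖(g z - P.glue h z) - (g w - P.glue h w)‖ ≤ (c + ε) * ‖z - w‖ := by
  obtain ⟨N₁, hN₁⟩ := P.locFinite z
  obtain ⟨N₂, hN₂⟩ := P.locFinite w
  obtain ⟨hz0, hz1⟩ := (hN₁ (max N₁ N₂) (le_max_left _ _)).self_of_nhds
  obtain ⟨hw0, hw1⟩ := (hN₂ (max N₁ N₂) (le_max_right _ _)).self_of_nhds
  generalize max N₁ N₂ = N at *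
  have key : ∀ x, (∀ n, N ≤ n → P.ψ n x = 0) → ∑ n ∈ Finset.range N, P.ψ n x = 1 →
      g x - P.glue h x = ∑ n ∈ Finset.range N, P.ψ n x • (g x - h n (P.k n x) x) := by
    intro x h0 h1
    simp only [smul_sub, Finset.sum_sub_distrib]
    rw [← Finset.sum_smul, h1, one_smul, P.glue_eq_sum h h0]
  rw [key z hz0 hz1, key w hw0 hw1, ← Finset.sum_sub_distrib]
  have hterm : ∀ n ∈ Finset.range N, ‖P.ψ n z • (g z - h n (P.k n z) z) -
      P.ψ n w • (g w - h n (P.k n w) w)‖ ≤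
      (b P n * ‖z - w‖) * P.tol ε n +
        P.ψ n w * ((c + 2 / P.ρ n * P.tol ε n) * ‖z - w‖) := by
    intro n _
    have hρ := P.ρ_pos n
    have ht := P.tol_pos hε n
    refine norm_smul_sub_smul_le (P.nonneg n w) (P.lip n z w) ht.le (by positivity)
      (fun h0 => ?_) (fun h0 => ?_) fun h1 h2 => ?_
    · rw [hB n _ z hz (P.mem n z h0)]; exact he _ _ _
    · rw [hB n _ w hw (P.mem n w h0)]; exact he _ _ _
    · rw [hB n _ z hz (P.mem n z h1), hB n _ w hw (P.mem n w h2)]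
      have h3 : 0 ≤ 2 / P.ρ n * P.tol ε n * ‖z - w‖ := by positivity
      rcases lt_or_ge (dist z w) (P.ρ n) with hd | hd
      · rw [P.congr n z w h1 h2 hd]
        linarith [heL n (P.k n w) z w]
      · rw [dist_eq_norm] at hd
        have h4 : ‖e n (P.k n z) z - e n (P.k n w) w‖ ≤ 2 * P.tol ε n := by
          linarith [norm_sub_le (e n (P.k n z) z) (e n (P.k n w) w), he n (P.k n z) z,
            he n (P.k n w) w]
        have h5 : 2 * P.tol ε n ≤ 2 / P.ρ n * P.tol ε n * ‖z - w‖ := by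
          calc 2 * P.tol ε n = 2 / P.ρ n * P.tol ε n * P.ρ n := by field_simp
            _ ≤ _ := by gcongr
        have h6 : 0 ≤ c * ‖z - w‖ := by positivity
        linarith
  refine (norm_sum_le_of_le _ hterm).trans ?_
  have hle1 : ∀ n ∈ Finset.range N, P.ψ n w ≤ 1 := fun n hn => by
    rw [← hw1]; exact Finset.single_le_sum (fun m _ => P.nonneg m w) hn
  calc ∑ n ∈ Finset.range N, ((b P n * ‖z - w‖) * P.tol ε n +
        P.ψ n w * ((c + 2 / P.ρ n * P.tol ε n) * ‖z - w‖))
      ≤ ∑ n ∈ Finset.range N, (P.ψ n w * (c * ‖z - w‖) + ε * (1 / 2) ^ (n + 1) * ‖z - w‖) := by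
        refine Finset.sum_le_sum fun n hn => ?_
        have hρ := P.ρ_pos n
        have ht := P.tol_pos hε n
        have h3 : 0 ≤ 2 / P.ρ n * P.tol ε n * ‖z - w‖ := by positivity
        rw [← P.den_mul_tol]
        nlinarith [mul_le_mul_of_nonneg_right (hle1 n hn) h3]
    _ = c * ‖z - w‖ + ε * (∑ n ∈ Finset.range N, (1 / 2 : ℝ) ^ (n + 1)) * ‖z - w‖ := by
        rw [Finset.sum_add_distrib, ← Finset.sum_mul, hw1, one_mul, ← Finset.sum_mul,
          ← Finset.mul_sum]
    _ ≤ c * ‖z - w‖ + ε * 1 * ‖z - w‖ := by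
        gcongr; exact sum_half_pow_le N
    _ = _ := by ring

/-- Where the local functions have nearly the value `v` and nearly the derivative `T`, the glued
function has nearly the derivative `T`. -/
theorem norm_fderiv_glue_sub_le {h : ℕ → I → X → Z} (hh : ∀ n i, ContDiff ℝ 1 (h n i)) {ε c : ℝ}
    (hε : 0 < ε) {x : X} {v : Z} {T : X →L[ℝ] Z}
    (hv : ∀ n i, x ∈ U i → ‖h n i x - v‖ ≤ P.tol ε n)
    (hT : ∀ n i, x ∈ U i → ‖fderiv ℝ (h n i) x - T‖ ≤ c) :
    ‖fderiv ℝ (P.glue h) x - T‖ ≤ c + ε := by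
  obtain ⟨N, i, hi, h1, hP⟩ := P.exists_eventually_glue_eq (Z := Z) x
  -- Since the weights sum to one near `x`, the affine map `v + T (y - x)` may be subtracted from
  -- every local function; derivatives of weights then multiply only small vectors.
  have hterm : ∀ n, HasFDerivAt (fun y => P.ψ n y • (h n (i n) y - v - T (y - x)))
      (P.ψ n x • (fderiv ℝ (h n (i n)) x - T) +
        (fderiv ℝ (P.ψ n) x).smulRight (h n (i n) x - v)) x := by
    intro n
    have hψ := (((P.contDiff n).differentiable one_ne_zero) x).hasFDerivAt
    have hd := (((hh n (i n)).differentiable one_ne_zero) x).hasFDerivAt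
    have hTd : HasFDerivAt (fun y => T (y - x)) T x := by
      simp only [map_sub]
      exact T.hasFDerivAt.sub_const _
    convert hψ.fun_smul ((hd.sub_const v).fun_sub hTd) using 1
    simp
  have hsum := HasFDerivAt.fun_sum (u := Finset.range N) fun n _ => hterm n
  have heq : P.glue h =ᶠ[𝓝 x] fun y =>
      (∑ n ∈ Finset.range N, P.ψ n y • (h n (i n) y - v - T (y - x))) + (v + T (y - x)) := by
    filter_upwards [h1, hP h] with y hy hy'
    rw [hy']
    simp only [smul_sub, Finset.sum_sub_distrib]
    rw [← Finset.sum_smul, hy, ← Finset.sum_smul, hy, one_smul, one_smul]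
    abel
  have hTd : HasFDerivAt (fun y => v + T (y - x)) T x := by
    simp only [map_sub]
    exact (T.hasFDerivAt.sub_const _).const_add v
  have hder := ((hsum.add hTd).congr_of_eventuallyEq heq).fderiv
  rw [hder, add_sub_cancel_right]
  have hle : ∀ n ∈ Finset.range N, ‖P.ψ n x • (fderiv ℝ (h n (i n)) x - T) +
      (fderiv ℝ (P.ψ n) x).smulRight (h n (i n) x - v)‖ ≤
      P.ψ n x * c + ε * (1 / 2) ^ (n + 1) := by
    intro n _
    rcases hi n with hU | h0
    · refine (norm_add_le _ _).trans (add_le_add ?_ ?_)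
      · rw [norm_smul, Real.norm_of_nonneg (P.nonneg n x)]
        exact mul_le_mul_of_nonneg_left (hT n _ hU) (P.nonneg n x)
      · rw [ContinuousLinearMap.norm_smulRight_apply, ← P.den_mul_tol]
        have hb : ‖fderiv ℝ (P.ψ n) x‖ ≤ P.b n :=
          norm_fderiv_le_of_lip' ℝ (P.b_nonneg n) (Eventually.of_forall fun y => P.lip n y x)
        refine mul_le_mul (hb.trans ?_) (hv n _ hU) (norm_nonneg _) (P.den_pos n).le
        have := P.ρ_pos n
        exact le_add_of_nonneg_right (by positivity)
    · have hz : fderiv ℝ (P.ψ n) x = 0 := by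
        have : P.ψ n =ᶠ[𝓝 x] fun _ => (0 : ℝ) := h0
        rw [this.fderiv_eq]; simp
      rw [hz, h0.self_of_nhds]
      simp; positivity
  refine (norm_sum_le_of_le _ hle).trans ?_
  rw [Finset.sum_add_distrib, ← Finset.sum_mul, h1.self_of_nhds, one_mul, ← Finset.mul_sum]
  have := mul_le_mul_of_nonneg_left (sum_half_pow_le N) hε.le
  linarith

end LevelPartition

/-! ### Local approximation of nearly affine mappings. -/

theorem PropertyE.exists_extension {X Z : Type*} [NormedAddCommGroup X]
    [NormedAddCommGroup Z] (hE : PropertyE X Z) :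
    ∃ K : ℝ, 0 ≤ K ∧ ∀ (S : Set X) (f : X → Z) (c : ℝ), 0 ≤ c →
      (∀ x ∈ S, ∀ y ∈ S, ‖f x - f y‖ ≤ c * ‖x - y‖) →
      ∃ F : X → Z, (∀ x y, ‖F x - F y‖ ≤ K * c * ‖x - y‖) ∧ ∀ x ∈ S, F x = f x := by
  obtain ⟨K, -, hE⟩ := hE
  refine ⟨K, K.coe_nonneg, fun S f c hc hf => ?_⟩
  lift c to ℝ≥0 using hc
  obtain ⟨F, hF, hFS⟩ := hE S f c (LipschitzOnWith.of_dist_le_mul fun x hx y hy => by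
    rw [dist_eq_norm, dist_eq_norm]; exact hf x hx y hy)
  refine ⟨F, fun x y => ?_, hFS⟩
  simpa [dist_eq_norm] using hF.dist_le_mul x y

section LocalApproximation

variable {X Z : Type*} [NormedAddCommGroup X] [NormedSpace ℝ X] [NormedAddCommGroup Z]
  [NormedSpace ℝ Z]

theorem PropertyStar.exists_approx (hStar : PropertyStar X Z) :
    ∃ C : ℝ, 0 ≤ C ∧ ∀ (f : X → Z) (c : ℝ), 0 ≤ c → (∀ x y, ‖f x - f y‖ ≤ c * ‖x - y‖) →
      ∀ ε > 0, ∃ g : X → Z, ContDiff ℝ 1 g ∧ (∀ x y, ‖g x - g y‖ ≤ C * c * ‖x - y‖) ∧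
        ∀ x, ‖f x - g x‖ ≤ ε := by
  obtain ⟨C, -, h⟩ := hStar
  refine ⟨C, C.coe_nonneg, fun f c hc hf ε hε => ?_⟩
  lift c to ℝ≥0 using hc
  obtain ⟨g, hg, hgL, hgf⟩ := h Set.univ f c (LipschitzOnWith.of_dist_le_mul fun x _ y _ => by
    rw [dist_eq_norm, dist_eq_norm]; exact hf x y) ε hε
  refine ⟨g, hg, fun x y => ?_, fun x => (hgf x trivial).le⟩
  simpa [dist_eq_norm] using hgL.dist_le_mul x y

/-- A mapping that is nearly affine on `S` is approximated on `S` by a `C¹` mapping whose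
derivative is everywhere close to the linear part. -/
theorem exists_contDiff_near_affine (hStar : PropertyStar X Z) (hE : PropertyE X Z) :
    ∃ C : ℝ, 0 ≤ C ∧ ∀ (S : Set X) (f : X → Z) (T : X →L[ℝ] Z) (c : ℝ), 0 ≤ c →
      (∀ x ∈ S, ∀ y ∈ S, ‖f x - f y - T (x - y)‖ ≤ c * ‖x - y‖) → ∀ δ > 0,
      ∃ h e : X → Z, ContDiff ℝ 1 h ∧ (∀ x, ‖e x‖ ≤ δ) ∧
        (∀ x y, ‖e x - e y‖ ≤ C * c * ‖x - y‖) ∧ (∀ x ∈ S, f x - h x = e x) ∧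
        (∀ x, ‖fderiv ℝ h x - T‖ ≤ C * c) ∧
        ∀ x y, ‖h x - h y‖ ≤ (‖T‖ + C * c) * ‖x - y‖ := by
  obtain ⟨K, hK, hE⟩ := hE.exists_extension
  obtain ⟨B, hB, hStar⟩ := hStar.exists_approx
  refine ⟨K + B * K, by positivity, fun S f T c hc hf δ hδ => ?_⟩
  obtain ⟨F, hF, hFS⟩ := hE S (fun x => f x - T x) c hc fun x hx y hy => by
    have h : f x - T x - (f y - T y) = f x - f y - T (x - y) := by rw [map_sub]; abel
    rw [h]; exact hf x hx y hy
  obtain ⟨g, hg, hgL, hgF⟩ := hStar F (K * c) (by positivity) hF δ hδ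
  have hKc : 0 ≤ K * c := by positivity
  refine ⟨fun x => T x + g x, fun x => F x - g x, T.contDiff.add hg, hgF, fun x y => ?_,
    fun x hx => ?_, fun x => ?_, fun x y => ?_⟩
  · have h : F x - g x - (F y - g y) = (F x - F y) - (g x - g y) := by abel
    rw [h]
    calc _ ≤ K * c * ‖x - y‖ + B * (K * c) * ‖x - y‖ :=
          (norm_sub_le _ _).trans (add_le_add (hF x y) (hgL x y))
      _ = _ := by ring
  · simp only [hFS x hx]; abel
  · have hd := T.hasFDerivAt.add (hg.differentiable one_ne_zero x).hasFDerivAt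
    have hd' : fderiv ℝ (fun x => T x + g x) x = T + fderiv ℝ g x := hd.fderiv
    rw [hd', add_sub_cancel_left]
    refine (norm_fderiv_le_of_lip' ℝ (C := B * (K * c)) (by positivity)
      (Eventually.of_forall fun y => hgL y x)).trans ?_
    linarith
  · have h : T x + g x - (T y + g y) = T (x - y) + (g x - g y) := by rw [map_sub]; abel
    rw [h]
    calc _ ≤ ‖T‖ * ‖x - y‖ + B * (K * c) * ‖x - y‖ :=
          (norm_add_le _ _).trans (add_le_add (T.le_opNorm _) (hgL x y))
      _ ≤ ‖T‖ * ‖x - y‖ + (B * (K * c) + K * c) * ‖x - y‖ := by gcongr; linarith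
      _ = _ := by ring

/-- The approximation of `exists_contDiff_near_affine` can moreover be made uniformly close to a
given Lipschitz extension `F`, with control of the Lipschitz constant of the difference. -/
theorem exists_contDiff_near_affine_of_lipschitz (hX : HasSmoothSeparation X)
    (hStar : PropertyStar X Z) (hE : PropertyE X Z) (K : ℝ) (hK : 0 ≤ K) :
    ∃ C Q : ℝ, 0 ≤ C ∧ 0 ≤ Q ∧ ∀ (S : Set X) (F : X → Z) (T : X →L[ℝ] Z) (c L : ℝ), 0 ≤ c →
      c ≤ L → 0 < L → ‖T‖ ≤ L → (∀ x y, ‖F x - F y‖ ≤ K * L * ‖x - y‖) →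
      (∀ x ∈ S, ∀ y ∈ S, ‖F x - F y - T (x - y)‖ ≤ c * ‖x - y‖) → ∀ δ > 0,
      ∃ h e : X → Z, ContDiff ℝ 1 h ∧ (∀ x, ‖e x‖ ≤ δ) ∧
        (∀ x y, ‖e x - e y‖ ≤ C * c * ‖x - y‖) ∧ (∀ x ∈ S, F x - h x = e x) ∧
        (∀ x ∈ S, ‖fderiv ℝ h x - T‖ ≤ C * c) ∧ (∀ x, ‖F x - h x‖ ≤ δ) ∧
        ∀ x y, ‖(F x - h x) - (F y - h y)‖ ≤ Q * L * ‖x - y‖ := by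
  obtain ⟨C, hC, hloc⟩ := exists_contDiff_near_affine hStar hE
  obtain ⟨B, hB, hStar⟩ := hStar.exists_approx
  obtain ⟨M, hM, hX⟩ := hX
  set q : ℝ := K + (1 + C) with hq
  have hq0 : 0 ≤ q := by positivity
  refine ⟨C, (M * (q + 1) + q) + (M + (K + B * K)), hC, by positivity,
    fun S F T c L hc hcL hL hT hF hFS δ hδ => ?_⟩
  -- An error of `L * r` on `S` grows to at most `(q + 1) * L * r = δ` within distance `r`. The
  -- cutoff slope `M / r` times `δ` is then a multiple of `L`, independent of `δ`.
  set r : ℝ := δ / ((q + 1) * L) with hr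
  have hr0 : 0 < r := by positivity
  have hrδ : (q + 1) * L * r = δ := by rw [hr]; field_simp
  have hLr : L * r ≤ δ := by rw [← hrδ]; nlinarith [mul_pos hL hr0]
  have hLr0 : 0 < L * r := by positivity
  obtain ⟨h₀, e, hh₀, he, heL, heS, hT₀, hh₀L⟩ := hloc S F T c hc hFS (L * r) hLr0
  obtain ⟨g, hg, hgL, hgF⟩ := hStar F (K * L) (by positivity) hF (L * r) hLr0
  obtain ⟨θ, hθ, hθ0, hθ1, hθL, hθS, hθr⟩ := hX S r hr0
  have huL : ∀ x y, ‖(F x - h₀ x) - (F y - h₀ y)‖ ≤ q * L * ‖x - y‖ := by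
    intro x y
    have h : (F x - h₀ x) - (F y - h₀ y) = (F x - F y) - (h₀ x - h₀ y) := by abel
    rw [h]
    calc _ ≤ K * L * ‖x - y‖ + (‖T‖ + C * c) * ‖x - y‖ :=
          (norm_sub_le _ _).trans (add_le_add (hF x y) (hh₀L x y))
      _ ≤ K * L * ‖x - y‖ + (L + C * L) * ‖x - y‖ := by gcongr
      _ = _ := by rw [hq]; ring
  have hvL : ∀ x y, ‖(F x - g x) - (F y - g y)‖ ≤ (K + B * K) * L * ‖x - y‖ := by
    intro x y
    have h : (F x - g x) - (F y - g y) = (F x - F y) - (g x - g y) := by abel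
    rw [h]
    calc _ ≤ K * L * ‖x - y‖ + B * (K * L) * ‖x - y‖ :=
          (norm_sub_le _ _).trans (add_le_add (hF x y) (hgL x y))
      _ = _ := by ring
  have hu : ∀ x, θ x ≠ 0 → ‖F x - h₀ x‖ ≤ δ := by
    intro x hx
    have hx' : x ∈ thickening r S := by
      by_contra h; exact hx (hθr x h)
    obtain ⟨a, ha, hxa⟩ := mem_thickening_iff.1 hx'
    rw [dist_eq_norm] at hxa
    have h1 : ‖F a - h₀ a‖ ≤ L * r := by rw [heS a ha]; exact he a
    have h2 := huL x a
    have h3 : q * L * ‖x - a‖ ≤ q * L * r := by gcongr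
    have h4 := norm_le_norm_add_norm_sub' (F x - h₀ x) (F a - h₀ a)
    rw [← hrδ]
    linarith
  have hsplit : ∀ x, F x - (θ x • h₀ x + (1 - θ x) • g x) =
      θ x • (F x - h₀ x) + (1 - θ x) • (F x - g x) := fun x => by module
  have hnear : ∀ x ∈ S, x ∈ thickening (r / 4) S := fun x hx =>
    self_subset_thickening (by positivity) _ hx
  -- Near `S` this is the nearly affine approximation `h₀`; away from `S` it is the smoothing `g` of
  -- `F`, which keeps it close to `F` everywhere.
  refine ⟨fun x => θ x • h₀ x + (1 - θ x) • g x, e,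
    (hθ.smul hh₀).add ((contDiff_const.sub hθ).smul hg), fun x => (he x).trans hLr, heL,
    fun x hx => ?_, fun x hx => ?_, fun x => ?_, fun x y => ?_⟩
  · simp only [hθS x (hnear x hx), one_smul, sub_self, zero_smul, add_zero]
    exact heS x hx
  · have heq : (fun x => θ x • h₀ x + (1 - θ x) • g x) =ᶠ[𝓝 x] h₀ := by
      filter_upwards [isOpen_thickening.mem_nhds (hnear x hx)] with y hy
      simp [hθS y hy]
    rw [heq.fderiv_eq]
    exact hT₀ x
  · simp only [hsplit]
    refine (norm_add_le _ _).trans ?_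
    have h1 : ‖θ x • (F x - h₀ x)‖ ≤ θ x * δ := by
      rw [norm_smul, Real.norm_of_nonneg (hθ0 x)]
      by_cases h0 : θ x = 0
      · simp [h0]
      · exact mul_le_mul_of_nonneg_left (hu x h0) (hθ0 x)
    have h2 : ‖(1 - θ x) • (F x - g x)‖ ≤ (1 - θ x) * δ := by
      rw [norm_smul, Real.norm_of_nonneg (sub_nonneg.2 (hθ1 x))]
      exact mul_le_mul_of_nonneg_left ((hgF x).trans hLr) (sub_nonneg.2 (hθ1 x))
    linarith
  · simp only [hsplit]
    have h : θ x • (F x - h₀ x) + (1 - θ x) • (F x - g x) -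
        (θ y • (F y - h₀ y) + (1 - θ y) • (F y - g y)) =
        (θ x • (F x - h₀ x) - θ y • (F y - h₀ y)) +
        ((1 - θ x) • (F x - g x) - (1 - θ y) • (F y - g y)) := by abel
    rw [h]
    have h1 := norm_smul_sub_smul_le (hθ0 y) (hθL x y) hδ.le
      (β := q * L * ‖x - y‖) (by positivity) (hu x) (hu y) fun _ _ => huL x y
    have h2 := norm_smul_sub_smul_le (s := 1 - θ x) (t := 1 - θ y) (sub_nonneg.2 (hθ1 y))
      (α := M / r * ‖x - y‖) (by rw [sub_sub_sub_cancel_left, abs_sub_comm]; exact hθL x y)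
      hLr0.le (β := (K + B * K) * L * ‖x - y‖) (by positivity)
      (fun _ => hgF x) (fun _ => hgF y) fun _ _ => hvL x y
    have h3 : M / r * ‖x - y‖ * δ = M * (q + 1) * L * ‖x - y‖ := by
      rw [← hrδ]; field_simp
    have h4 : M / r * ‖x - y‖ * (L * r) = M * L * ‖x - y‖ := by field_simp
    have h5 : θ y * (q * L * ‖x - y‖) ≤ q * L * ‖x - y‖ :=
      mul_le_of_le_one_left (by positivity) (hθ1 y)
    have h6 : (1 - θ y) * ((K + B * K) * L * ‖x - y‖) ≤ (K + B * K) * L * ‖x - y‖ :=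
      mul_le_of_le_one_left (by positivity) (by linarith [hθ0 y])
    refine (norm_add_le _ _).trans ?_
    rw [h3] at h1
    rw [h4] at h2
    linarith

end LocalApproximation

/-! ### The mean value condition, global approximation and iteration. -/

section Extension

variable {X Z : Type*} [NormedAddCommGroup X] [NormedSpace ℝ X] [NormedAddCommGroup Z]
  [NormedSpace ℝ Z] {A : Set X} {f : X → Z} {D : X → X →L[ℝ] Z}

theorem ContDiff.meanValueCondition {G : X → Z} (hG : ContDiff ℝ 1 G) (A : Set X) :
    MeanValueCondition A G (fderiv ℝ G) := by
  refine ⟨(hG.continuous_fderiv one_ne_zero).continuousOn, fun y _ ε hε => ?_⟩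
  have h := (hG.contDiffAt (x := y)).hasStrictFDerivAt one_ne_zero
  have hb := h.isLittleO.def hε
  rw [nhds_prod_eq] at hb
  obtain ⟨r, hr, hball⟩ := (nhds_basis_ball.prod_self.eventually_iff).1 hb
  exact ⟨r, hr, fun z hz w hw => hball (x := (z, w)) ⟨hz.2, hw.2⟩⟩

theorem MeanValueCondition.congr {f' : X → Z} {D' : X → X →L[ℝ] Z}
    (h : MeanValueCondition A f D) (hf : ∀ x ∈ A, f' x = f x) (hD : ∀ x ∈ A, D' x = D x) :
    MeanValueCondition A f' D' := by
  refine ⟨h.1.congr hD, fun y hy ε hε => ?_⟩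
  obtain ⟨r, hr, hb⟩ := h.2 y hy ε hε
  refine ⟨r, hr, fun z hz w hw => ?_⟩
  rw [hf z hz.1, hf w hw.1, hD y hy]
  exact hb z hz w hw

theorem MeanValueCondition.sub {f' : X → Z} {D' : X → X →L[ℝ] Z}
    (h : MeanValueCondition A f D) (h' : MeanValueCondition A f' D') :
    MeanValueCondition A (fun x => f x - f' x) (fun x => D x - D' x) := by
  refine ⟨h.1.sub h'.1, fun y hy ε hε => ?_⟩
  obtain ⟨r, hr, hb⟩ := h.2 y hy (ε / 2) (half_pos hε)
  obtain ⟨r', hr', hb'⟩ := h'.2 y hy (ε / 2) (half_pos hε)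
  refine ⟨min r r', lt_min hr hr', fun z hz w hw => ?_⟩
  have h1 := hb z ⟨hz.1, ball_subset_ball (min_le_left _ _) hz.2⟩ w
    ⟨hw.1, ball_subset_ball (min_le_left _ _) hw.2⟩
  have h2 := hb' z ⟨hz.1, ball_subset_ball (min_le_right _ _) hz.2⟩ w
    ⟨hw.1, ball_subset_ball (min_le_right _ _) hw.2⟩
  have h3 : f z - f' z - (f w - f' w) - (D y - D' y) (z - w) =
      (f z - f w - D y (z - w)) - (f' z - f' w - D' y (z - w)) := by
    rw [sub_apply]; abel
  rw [h3]
  refine (norm_sub_le _ _).trans ?_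
  linarith

/-- The mean value condition provides an open cover on whose members `f` is nearly affine. -/
theorem MeanValueCondition.exists_cover (hA : IsClosed A) (h : MeanValueCondition A f D) {ε : ℝ}
    (hε : 0 < ε) : ∃ (U : X → Set X) (T : X → X →L[ℝ] Z), (∀ y, IsOpen (U y)) ∧ (∀ y, y ∈ U y) ∧
      (∀ y, ∀ z ∈ A ∩ U y, ∀ w ∈ A ∩ U y, ‖f z - f w - T y (z - w)‖ ≤ ε * ‖z - w‖) ∧
      (∀ y, ∀ x ∈ A ∩ U y, ‖T y - D x‖ ≤ ε) ∧
      ∀ L : ℝ, 0 ≤ L → (∀ x ∈ A, ‖D x‖ ≤ L) → ∀ y, ‖T y‖ ≤ L := by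
  have key : ∀ y, ∃ (U : Set X) (T : X →L[ℝ] Z), IsOpen U ∧ y ∈ U ∧
      (∀ z ∈ A ∩ U, ∀ w ∈ A ∩ U, ‖f z - f w - T (z - w)‖ ≤ ε * ‖z - w‖) ∧
      (∀ x ∈ A ∩ U, ‖T - D x‖ ≤ ε) ∧
      ∀ L : ℝ, 0 ≤ L → (∀ x ∈ A, ‖D x‖ ≤ L) → ‖T‖ ≤ L := by
    intro y
    by_cases hy : y ∈ A
    · obtain ⟨r, hr, hb⟩ := h.2 y hy ε hε
      obtain ⟨s, hs, hc⟩ := continuousOn_iff.1 h.1 y hy ε hε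
      refine ⟨ball y (min r s), D y, isOpen_ball, mem_ball_self (lt_min hr hs),
        fun z hz w hw => ?_, fun x hx => ?_, fun L _ hL => hL y hy⟩
      · exact hb z ⟨hz.1, ball_subset_ball (min_le_left _ _) hz.2⟩ w
          ⟨hw.1, ball_subset_ball (min_le_left _ _) hw.2⟩
      · have := hc x hx.1 (ball_subset_ball (min_le_right _ _) hx.2)
        rw [← dist_eq_norm, dist_comm]
        exact this.le
    · refine ⟨Aᶜ, 0, hA.isOpen_compl, hy, fun z hz => absurd hz.1 hz.2,
        fun x hx => absurd hx.1 hx.2, fun L hL _ => by simpa using hL⟩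
  choose U T h1 h2 h3 h4 h5 using key
  exact ⟨U, T, h1, h2, h3, h4, fun L hL hD y => h5 y L hL hD⟩

/-- The starting step: nothing global is assumed of `f`, so no global Lipschitz bound on `H` is
available, but the residual becomes Lipschitz on `A`. -/
theorem MeanValueCondition.exists_approx (hX : HasSmoothSeparation X) (hStar : PropertyStar X Z)
    (hE : PropertyE X Z) (hA : IsClosed A) (h : MeanValueCondition A f D) {η : ℝ} (hη : 0 < η) :
    ∃ H : X → Z, ContDiff ℝ 1 H ∧
      (∀ x ∈ A, ∀ y ∈ A, ‖(f x - H x) - (f y - H y)‖ ≤ η * ‖x - y‖) ∧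
      ∀ x ∈ A, ‖D x - fderiv ℝ H x‖ ≤ η := by
  obtain ⟨C, hC, hloc⟩ := exists_contDiff_near_affine hStar hE
  set ε : ℝ := η / (C + 2) with hε
  have hε0 : 0 < ε := by positivity
  have hεη : (C * ε + ε) + ε = η := by rw [hε]; field_simp; ring
  obtain ⟨U, T, hU, hmem, hf, hD, -⟩ := h.exists_cover hA hε0
  obtain ⟨P⟩ := hX.exists_levelPartition U hU fun x => ⟨x, hmem x⟩
  choose g e hg he heL heS hT _ using fun n i =>
    hloc (A ∩ U i) f (T i) ε hε0.le (hf i) (P.tol ε n) (P.tol_pos hε0 n)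
  refine ⟨P.glue g, P.contDiff_glue hg, fun x hx y hy => ?_, fun x hx => ?_⟩
  · refine (P.norm_sub_glue_le hε0 (by positivity) he heL
      (fun n i z hz hi => heS n i z ⟨hz, hi⟩) hx hy).trans ?_
    gcongr
    linarith
  · rw [norm_sub_rev, ← hεη]
    refine P.norm_fderiv_glue_sub_le hg hε0 (v := f x) (fun n i hi => ?_) fun n i hi => ?_
    · rw [norm_sub_rev, heS n i x ⟨hx, hi⟩]; exact he n i x
    · exact (norm_sub_le_norm_sub_add_norm_sub _ (T i) _).trans
        (add_le_add (hT n i x) (hD i x ⟨hx, hi⟩))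

/-- The local functions are kept close to one global Lipschitz extension `F` of `f`. Gluing
estimates then apply twice: on `A` with error of order `ε`, and on all of `X` with error of order
`L`. -/
theorem exists_approx_of_lipschitz (hX : HasSmoothSeparation X) (hStar : PropertyStar X Z)
    (hE : PropertyE X Z) (hA : IsClosed A) :
    ∃ Q : ℝ, 0 ≤ Q ∧ ∀ (f : X → Z) (D : X → X →L[ℝ] Z), MeanValueCondition A f D →
      ∀ L > 0, (∀ x ∈ A, ∀ y ∈ A, ‖f x - f y‖ ≤ L * ‖x - y‖) → (∀ x ∈ A, ‖D x‖ ≤ L) → ∀ η > 0,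
      ∃ H : X → Z, ContDiff ℝ 1 H ∧
        (∀ x ∈ A, ∀ y ∈ A, ‖(f x - H x) - (f y - H y)‖ ≤ η * ‖x - y‖) ∧
        (∀ x ∈ A, ‖D x - fderiv ℝ H x‖ ≤ η) ∧ ∀ x y, ‖H x - H y‖ ≤ Q * L * ‖x - y‖ := by
  obtain ⟨K, hK, hext⟩ := hE.exists_extension
  obtain ⟨C, Q, hC, hQ, hloc⟩ := exists_contDiff_near_affine_of_lipschitz hX hStar hE K hK
  refine ⟨K + (Q + 1), by positivity, fun f D h L hL hfL hDL η hη => ?_⟩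
  obtain ⟨F, hF, hFA⟩ := hext A f L hL.le hfL
  -- The bound `ε ≤ L` keeps the global gluing loss proportional to `L`.
  set ε : ℝ := min L (η / (C + 2)) with hε
  have hε0 : 0 < ε := lt_min hL (by positivity)
  have hεL : ε ≤ L := min_le_left _ _
  have hεη : (C * ε + ε) + ε ≤ η := by
    have h1 : ε ≤ η / (C + 2) := min_le_right _ _
    rw [le_div_iff₀ (by positivity)] at h1
    linarith
  obtain ⟨U, T, hU, hmem, hf, hD, hT⟩ := h.exists_cover hA hε0
  obtain ⟨P⟩ := hX.exists_levelPartition U hU fun x => ⟨x, hmem x⟩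
  choose g e hg he heL heS hTg hgF hgL using fun n i =>
    hloc (A ∩ U i) F (T i) ε L hε0.le hεL hL (hT L hL.le hDL i) hF
      (fun z hz w hw => by rw [hFA z hz.1, hFA w hw.1]; exact hf i z hz w hw)
      (P.tol ε n) (P.tol_pos hε0 n)
  refine ⟨P.glue g, P.contDiff_glue hg, fun x hx y hy => ?_, fun x hx => ?_, fun x y => ?_⟩
  · rw [← hFA x hx, ← hFA y hy]
    refine (P.norm_sub_glue_le hε0 (by positivity) he heL
      (fun n i z hz hi => heS n i z ⟨hz, hi⟩) hx hy).trans ?_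
    gcongr
    linarith
  · rw [norm_sub_rev]
    refine (P.norm_fderiv_glue_sub_le hg hε0 (v := F x) (c := C * ε + ε)
      (fun n i hi => ?_) fun n i hi => ?_).trans hεη
    · rw [norm_sub_rev]; exact hgF n i x
    · exact (norm_sub_le_norm_sub_add_norm_sub _ (T i) _).trans
        (add_le_add (hTg n i x ⟨hx, hi⟩) (hD i x ⟨hx, hi⟩))
  · have h1 := P.norm_sub_glue_le (B := Set.univ) hε0 (by positivity) hgF hgL
      (fun _ _ _ _ _ => rfl) (Set.mem_univ x) (Set.mem_univ y)
    have h2 : P.glue g x - P.glue g y =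
        (F x - F y) - ((F x - P.glue g x) - (F y - P.glue g y)) := by abel
    rw [h2]
    calc _ ≤ K * L * ‖x - y‖ + (Q * L + ε) * ‖x - y‖ :=
          (norm_sub_le _ _).trans (add_le_add (hF x y) h1)
      _ ≤ K * L * ‖x - y‖ + (Q * L + L) * ‖x - y‖ := by gcongr
      _ = _ := by ring

/-- Successive approximation of `(f, D)` on `A`, pinned at a point `a`. -/
theorem MeanValueCondition.exists_seq (hX : HasSmoothSeparation X) (hStar : PropertyStar X Z)
    (hE : PropertyE X Z) (hA : IsClosed A) (h : MeanValueCondition A f D) (a : X) :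
    ∃ (Q : ℝ) (H : ℕ → X → Z), (∀ n, ContDiff ℝ 1 (H n)) ∧ (∀ n, H n a = f a) ∧
      (∀ n, ∀ x ∈ A, ∀ y ∈ A, ‖(f x - H n x) - (f y - H n y)‖ ≤ (1 / 2) ^ n * ‖x - y‖) ∧
      (∀ n, ∀ x ∈ A, ‖D x - fderiv ℝ (H n) x‖ ≤ (1 / 2) ^ n) ∧
      ∀ n x y, ‖(H n x - H (n + 1) x) - (H n y - H (n + 1) y)‖ ≤ Q * (1 / 2) ^ n * ‖x - y‖ := by
  obtain ⟨Q, hQ, hstep⟩ := exists_approx_of_lipschitz hX hStar hE hA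
  let Good : ℕ → (X → Z) → Prop := fun n G => ContDiff ℝ 1 G ∧ G a = f a ∧
    (∀ x ∈ A, ∀ y ∈ A, ‖(f x - G x) - (f y - G y)‖ ≤ (1 / 2) ^ n * ‖x - y‖) ∧
    ∀ x ∈ A, ‖D x - fderiv ℝ G x‖ ≤ (1 / 2) ^ n
  have h0 : ∃ G, Good 0 G := by
    obtain ⟨G, hG, hGL, hGD⟩ := h.exists_approx hX hStar hE hA one_pos
    refine ⟨fun x => G x + (f a - G a), hG.add contDiff_const, by simp, fun x hx y hy => ?_,
      fun x hx => ?_⟩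
    · rw [sub_add_eq_sub_sub, sub_add_eq_sub_sub, sub_sub_sub_cancel_right, pow_zero]
      exact hGL x hx y hy
    · rw [fderiv_add_const, pow_zero]
      exact hGD x hx
  have hs : ∀ n G, Good n G → ∃ G', Good (n + 1) G' ∧
      ∀ x y, ‖(G x - G' x) - (G y - G' y)‖ ≤ Q * (1 / 2) ^ n * ‖x - y‖ := by
    rintro n G ⟨hG, hGa, hGL, hGD⟩
    -- The residual of `G` has Lipschitz constant and derivative data of size `(1 / 2) ^ n`, so the
    -- global bound on the correction is geometric too.
    obtain ⟨g, hg, hgL, hgD, hgQ⟩ := hstep _ _ (h.sub (hG.meanValueCondition A)) ((1 / 2) ^ n)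
      (by positivity) hGL hGD ((1 / 2) ^ (n + 1)) (by positivity)
    refine ⟨fun x => G x + g x - g a, ⟨(hG.add hg).sub contDiff_const, by simp [hGa],
      fun x hx y hy => ?_, fun x hx => ?_⟩, fun x y => ?_⟩
    · refine le_of_eq_of_le (congrArg norm ?_) (hgL x hx y hy)
      module
    · rw [fderiv_sub_const, fderiv_fun_add (hG.differentiable one_ne_zero x)
        (hg.differentiable one_ne_zero x), ← sub_sub]
      exact hgD x hx
    · refine le_of_eq_of_le ?_ (hgQ x y)
      rw [← norm_neg]
      congr 1
      module
  choose! refined hrefined hrefinedQ using hs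
  obtain ⟨G₀, hG₀⟩ := h0
  let H : ℕ → X → Z := fun n => Nat.rec G₀ (fun n G => refined n G) n
  have hH : ∀ n, Good n (H n) := by
    intro n
    induction n with
    | zero => exact hG₀
    | succ n ih => exact hrefined n _ ih
  exact ⟨Q, H, fun n => (hH n).1, fun n => (hH n).2.1, fun n => (hH n).2.2.1,
    fun n => (hH n).2.2.2, fun n => hrefinedQ n _ (hH n)⟩

/-- A sequence of `C¹` mappings whose consecutive differences have geometrically small Lipschitz
constants and which is constant at a point converges, with its derivatives, to a `C¹` mapping. -/
theorem exists_contDiff_limit [CompleteSpace Z] {H : ℕ → X → Z} {Q : ℝ} {a : X} {b : Z}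
    (hH : ∀ n, ContDiff ℝ 1 (H n)) (ha : ∀ n, H n a = b)
    (hQ : ∀ n x y, ‖(H n x - H (n + 1) x) - (H n y - H (n + 1) y)‖ ≤ Q * (1 / 2) ^ n * ‖x - y‖) :
    ∃ G : X → Z, ContDiff ℝ 1 G ∧ (∀ x, Tendsto (fun n => H n x) atTop (𝓝 (G x))) ∧
      ∀ x, Tendsto (fun n => fderiv ℝ (H n) x) atTop (𝓝 (fderiv ℝ G x)) := by
  have hQa : ∀ n, Q * (1 / 2) ^ n ≤ |Q| * (1 / 2) ^ n := fun n => by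
    gcongr; exact le_abs_self Q
  have hdiff : ∀ n x, DifferentiableAt ℝ (H n) x := fun n => (hH n).differentiable one_ne_zero
  have h1 : ∀ x n, dist (H n x) (H (n + 1) x) ≤ |Q| * ‖x - a‖ * (1 / 2) ^ n := by
    intro x n
    have := hQ n x a
    rw [ha, ha, sub_self, sub_zero] at this
    rw [dist_eq_norm]
    nlinarith [mul_le_mul_of_nonneg_right (hQa n) (norm_nonneg (x - a))]
  have h2 : ∀ x n, dist (fderiv ℝ (H n) x) (fderiv ℝ (H (n + 1)) x) ≤ |Q| * (1 / 2) ^ n := by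
    intro x n
    rw [dist_eq_norm, ← fderiv_fun_sub (hdiff n x) (hdiff (n + 1) x)]
    refine norm_fderiv_le_of_lip' ℝ (by positivity) (Eventually.of_forall fun y => ?_)
    exact (hQ n y x).trans (by gcongr; exact le_abs_self Q)
  have hhalf : (1 / 2 : ℝ) < 1 := by norm_num
  choose G hG using fun x => cauchySeq_tendsto_of_complete
    (cauchySeq_of_le_geometric (1 / 2) _ hhalf (h1 x))
  choose G' hG' using fun x => cauchySeq_tendsto_of_complete
    (cauchySeq_of_le_geometric (1 / 2) _ hhalf (h2 x))
  have hunif : TendstoUniformly (fun n => fderiv ℝ (H n)) G' atTop := by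
    rw [Metric.tendstoUniformly_iff]
    intro ε hε
    have hlim : Tendsto (fun n : ℕ => |Q| * (1 / 2 : ℝ) ^ n / (1 - 1 / 2)) atTop (𝓝 0) := by
      have := ((tendsto_pow_atTop_nhds_zero_of_lt_one (r := (1 / 2 : ℝ)) (by norm_num)
        hhalf).const_mul |Q|).div_const (1 - 1 / 2)
      simpa using this
    filter_upwards [hlim.eventually_lt_const hε] with n hn x
    rw [dist_comm]
    exact (dist_le_of_le_geometric_of_tendsto (1 / 2) _ hhalf (h2 x) (hG' x) n).trans_lt hn
  have hder : ∀ x, HasFDerivAt G (G' x) x :=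
    hasFDerivAt_of_tendstoUniformly hunif (fun n x => (hdiff n x).hasFDerivAt) hG
  have hfd : fderiv ℝ G = G' := funext fun x => (hder x).fderiv
  refine ⟨G, contDiff_one_iff_fderiv.2 ⟨fun x => (hder x).differentiableAt, ?_⟩, hG,
    fun x => by rw [hfd]; exact hG' x⟩
  rw [hfd]
  exact hunif.continuous (Frequently.of_forall fun n => (hH n).continuous_fderiv one_ne_zero)

end Extension

theorem theorem3p1 {X Z : Type*}
    [NormedAddCommGroup X] [NormedSpace ℝ X] [CompleteSpace X]
    [NormedAddCommGroup Z] [NormedSpace ℝ Z] [CompleteSpace Z]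
    (hStar : PropertyStar X Z) (hE : PropertyE X Z)
    (A : Set X) (hA : IsClosed A) (f : X → Z) (D : X → X →L[ℝ] Z) :
    MeanValueCondition A f D ↔
      ∃ G : X → Z, ContDiff ℝ 1 G ∧ (∀ y ∈ A, G y = f y) ∧
        ∀ y ∈ A, HasFDerivAt G (D y) y := by
  constructor
  · intro h
    -- Scalar bump functions come from Property (*) only when `Z` contains a unit vector.
    rcases subsingleton_or_nontrivial Z with hZ | hZ
    · refine ⟨fun _ => 0, contDiff_const, fun y _ => Subsingleton.elim _ _, fun y _ => ?_⟩
      rw [Subsingleton.elim (D y) 0]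
      exact hasFDerivAt_const 0 y
    rcases A.eq_empty_or_nonempty with rfl | ⟨a, ha⟩
    · exact ⟨fun _ => 0, contDiff_const, by simp, by simp⟩
    obtain ⟨Q, H, hH, hHa, hHf, hHD, hQ⟩ :=
      h.exists_seq hStar.real.hasSmoothSeparation hStar hE hA a
    obtain ⟨G, hG, hlim, hlim'⟩ := exists_contDiff_limit hH hHa hQ
    have hpow : Tendsto (fun n : ℕ => (1 / 2 : ℝ) ^ n) atTop (𝓝 0) :=
      tendsto_pow_atTop_nhds_zero_of_lt_one (by norm_num) (by norm_num)
    refine ⟨G, hG, fun y hy => ?_, fun y hy => ?_⟩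
    · refine tendsto_nhds_unique (hlim y) ?_
      rw [tendsto_iff_norm_sub_tendsto_zero]
      refine squeeze_zero (fun _ => norm_nonneg _) (fun n => ?_)
        (zero_mul ‖y - a‖ ▸ hpow.mul_const ‖y - a‖)
      -- Pinning at `a ∈ A` turns the Lipschitz bound on the residual into a pointwise bound.
      have := hHf n y hy a ha
      rwa [hHa, sub_self, sub_zero, norm_sub_rev] at this
    · have hD : fderiv ℝ G y = D y := by
        refine tendsto_nhds_unique (hlim' y) ?_
        rw [tendsto_iff_norm_sub_tendsto_zero]
        refine squeeze_zero (fun _ => norm_nonneg _) (fun n => ?_) hpow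
        rw [norm_sub_rev]
        exact hHD n y hy
      rw [← hD]
      exact (hG.differentiable one_ne_zero y).hasFDerivAt
  · rintro ⟨G, hG, hGf, hGD⟩
    exact (hG.meanValueCondition A).congr (fun x hx => (hGf x hx).symm)
      fun x hx => (hGD x hx).fderiv.symm
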